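/- Let $d\ge 2$, $n\ge 0$ be integers, $0<r<1$, and let $s,t\in[0,1]^d$ with $w=\|t-s\|>r$. Let $V$ consist of $s$, $t$ and $n$ further points chosen independently and uniformly at random from $[0,1]^d$. Let $K\ge 1$ be the smallest integer with $l:=w/(4K+1)\le r/4$, and let $0<h\le\frac18\sqrt{\frac{7}{d-1}}\,r$. Use orthonormal coordinates $x_0,\dots,x_{d-1}$ in which $s=(0,\dots,0)$ and $t=(w,0,\dots,0)$. For $z\in\mathbb Z^d$ the box $R(z)$ is the set of points with $lz_0\le x_0\le l(z_0+1)$ and $(z_i-\frac12)h\le x_i\le(z_i+\frac12)h$ for $1\le i\le d-1$; a box is empty if it contains no point of $V$. The channel $\mathrm{ch}(h)$ is the union of the boxes $R(z)$ for which there is an integer $k$ with $0\le k\le 2K$, $z_0=2k$, and $|z_i|\le\min(k,2K-k)$, $z_i\equiv k\pmod 2$ for $1\le i\le d-1$; assume that $\mathrm{ch}(h)\subseteq[0,1]^d$. A jump-path in $\mathrm{ch}(h)$ is a sequence of non-empty boxes $B_0=R(0,\dots,0),B_1,\dots,B_{2K}=R(4K,0,\dots,0)$ such that, whenever $B_j=R(z)$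 and $B_{j+1}=R(z')$ with $0\le j<2K$, we have $z'_0=z_0+2$ and $|z'_i-z_i|=1$ for $1\le i\le d-1$. Let $q$ be the probability that a single box of the channel, other than the two end boxes $R(0,\dots,0)\ni s$ and $R(4K,0,\dots,0)\ni t$, is empty (it is the same for all these boxes, namely $q=(1-lh^{d-1})^n$). There are absolute constants $q_0\in(0,1)$ and $c>0$ such that, in every such situation, if $q<q_0$ then $$\Pr[\text{there is no jump-path in }\mathrm{ch}(h)]\le (cq)^{2^{d-3}}.$$ -/

import Mathlib

open MeasureTheory ProbabilityTheory

noncomputable section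

namespace UnitDiskChannel

/-- The cube `[0,1]^d` in Euclidean space. -/
def unitCube (d : ℕ) : Set (EuclideanSpace ℝ (Fin d)) :=
  {x | ∀ i, 0 ≤ x i ∧ x i ≤ 1}

/-- The smallest integer `K ≥ 1` with `w / (4K + 1) ≤ r / 4`
(it exists as soon as `r > 0`). -/
def channelK (w r : ℝ) : ℕ :=
  sInf {K : ℕ | 1 ≤ K ∧ w / (4 * (K : ℝ) + 1) ≤ r / 4}

/-- The side length `l = w / (4K + 1)` of a box along the first axis. -/
def channelL (w r : ℝ) : ℝ :=
  w / (4 * (channelK w r : ℝ) + 1)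

variable {d : ℕ} [NeZero d]

/-- The closed box `R(z₀, …, z_{d-1})` of size `l × h × ⋯ × h`, in the coordinate system with
origin `s` and axes `b 0, …, b (d-1)`: the `i`-th coordinate of `x` is `b.repr (x - s) i`. -/
def box (b : OrthonormalBasis (Fin d) ℝ (EuclideanSpace ℝ (Fin d)))
    (s : EuclideanSpace ℝ (Fin d)) (l h : ℝ) (z : Fin d → ℤ) :
    Set (EuclideanSpace ℝ (Fin d)) :=
  {x | l * (z 0 : ℝ) ≤ b.repr (x - s) 0 ∧ b.repr (x - s) 0 ≤ l * ((z 0 : ℝ) + 1) ∧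
    ∀ i : Fin d, i ≠ 0 →
      (-1 / 2 + (z i : ℝ)) * h ≤ b.repr (x - s) i ∧
      b.repr (x - s) i ≤ (1 / 2 + (z i : ℝ)) * h}

/-- One can jump from the box with index `z` to the box with index `z'`. -/
def CanJump (z z' : Fin d → ℤ) : Prop :=
  z' 0 = z 0 + 2 ∧ ∀ i : Fin d, i ≠ 0 → |z' i - z i| = 1

/-- The index `(4K, 0, …, 0)` of the last box; the index of the first box is `0`. -/
def endIndex (d : ℕ) [NeZero d] (K : ℕ) : Fin d → ℤ :=
  Pi.single 0 (4 * (K : ℤ))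

/-- The conditions on the index `z` of a box that make it one of the boxes of the channel. -/
def IsChannelIndex (K : ℕ) (z : Fin d → ℤ) : Prop :=
  ∃ k : ℤ, 0 ≤ k ∧ k ≤ 2 * (K : ℤ) ∧ z 0 = 2 * k ∧
    ∀ i : Fin d, i ≠ 0 → |z i| ≤ min k (2 * (K : ℤ) - k) ∧ z i ≡ k [ZMOD 2]

/-- The channel: the union of its boxes. -/
def channel (b : OrthonormalBasis (Fin d) ℝ (EuclideanSpace ℝ (Fin d)))
    (s : EuclideanSpace ℝ (Fin d)) (K : ℕ) (l h : ℝ) : Set (EuclideanSpace ℝ (Fin d)) :=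
  ⋃ z ∈ {z : Fin d → ℤ | IsChannelIndex K z}, box b s l h z

/-- The vertex set of the graph: the query vertices `s`, `t` and the points `x 0, …, x (n-1)`. -/
def vertexSet {n : ℕ} (s t : EuclideanSpace ℝ (Fin d))
    (x : Fin n → EuclideanSpace ℝ (Fin d)) : Set (EuclideanSpace ℝ (Fin d)) :=
  {s, t} ∪ Set.range x

/-- The box with index `z` contains no point of `V`. -/
def IsEmptyBox (b : OrthonormalBasis (Fin d) ℝ (EuclideanSpace ℝ (Fin d)))
    (s : EuclideanSpace ℝ (Fin d)) (l h : ℝ) (V : Set (EuclideanSpace ℝ (Fin d)))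
    (z : Fin d → ℤ) : Prop :=
  box b s l h z ∩ V = ∅

/-- There is a jump-path: a sequence `B 0, …, B (2K)` of non-empty boxes from `R(0, …, 0)` to
`R(4K, 0, …, 0)` such that one can jump from each box to the next. -/
def HasJumpPath (b : OrthonormalBasis (Fin d) ℝ (EuclideanSpace ℝ (Fin d)))
    (s : EuclideanSpace ℝ (Fin d)) (K : ℕ) (l h : ℝ)
    (V : Set (EuclideanSpace ℝ (Fin d))) : Prop :=
  ∃ B : ℕ → Fin d → ℤ,
    B 0 = 0 ∧ B (2 * K) = endIndex d K ∧
    (∀ j, j < 2 * K → CanJump (B j) (B (j + 1))) ∧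
    ∀ j, j ≤ 2 * K → ¬ IsEmptyBox b s l h V (B j)

end UnitDiskChannel

end

/-! Each sign vector `σ` in {±1}^(d-1) selects the half-plane z_i = σ_i j, j ≥ 1, which meets the
channel in a planar half diamond; these 2^(d-1) half diamonds share no box. A lattice path with
steps ±1 that crosses one of them through non-empty boxes is a jump-path, so failure requires all of
them to be blocked.

Blocking is a Peierls argument. If neither site next to an apex can be reached from below the axis
by steps going diagonally down, or two up into an empty site, then the lowest unreachable sites of
the columns form a crossing (`exists_crossing`). A walk of m steps from height ≤ 0 to height 1 with
u up-steps satisfies 2u - (m - u) ≥ 1, hence 3u ≥ m + 1, while at most 3^m walks of m steps end at a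
given site. With y = q^(1/3), the weights of all cuts sum to at most 4y (`exists_cut_family`).

Emptiness of disjoint boxes is negatively correlated (`measureReal_forall_notMem_le`). A union bound
over choices of one cut per half diamond gives (4y)^(2^(d-1)) = (64q)^(2^(d-1)/3), and 2^(d-1)/3 ≥
2^(d-3). -/

namespace UnitDiskChannel

/-! ### Walks that produce planar cuts -/

/-- The sites `(k, j)` strictly above the axis of the planar diamond with apexes `(0, 0)` and
`(2K, 0)`. -/
def halfDiamond (K : ℕ) : Set (ℤ × ℤ) :=
  {x | 1 ≤ x.2 ∧ x.2 ≤ x.1 ∧ x.2 ≤ 2 * (K : ℤ) - x.1 ∧ x.2 ≡ x.1 [ZMOD 2]}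

lemma halfDiamond_finite (K : ℕ) : (halfDiamond K).Finite := by
  refine (Set.finite_Icc ((0, 0) : ℤ × ℤ) (2 * (K : ℤ), 2 * (K : ℤ))).subset ?_
  rintro ⟨k, j⟩ ⟨h1, h2, h3, -⟩
  simp only at h1 h2 h3
  simp only [Set.mem_Icc, Prod.mk_le_mk]
  omega

/-- The sites that can be reached from below the axis in at most `n` steps, where a step goes
diagonally down, or straight up into a site of `Q`. -/
def reach (Q : Set (ℤ × ℤ)) : ℕ → Set (ℤ × ℤ)
  | 0 => {x | x.2 ≤ 0}
  | n + 1 => reach Q n ∪ {x | (x.1 + 1, x.2 + 1) ∈ reach Q n ∨ (x.1 - 1, x.2 + 1) ∈ reach Q n ∨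
      (x ∈ Q ∧ (x.1, x.2 - 2) ∈ reach Q n)}

/-- The sets of sites entered by up-steps along a walk of `n` steps, each diagonally down or
straight up, that ends in the given site. -/
def walkCuts : ℕ → ℤ × ℤ → Finset (Finset (ℤ × ℤ))
  | 0, _ => {∅}
  | n + 1, x => walkCuts n (x.1 + 1, x.2 + 1) ∪ walkCuts n (x.1 - 1, x.2 + 1) ∪
      (walkCuts n (x.1, x.2 - 2)).image (insert x)

lemma card_walkCuts_le (n : ℕ) (x : ℤ × ℤ) : (walkCuts n x).card ≤ 3 ^ n := by
  induction n generalizing x with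
  | zero => simp [walkCuts]
  | succ n ih =>
    have h1 := Finset.card_union_le
      (walkCuts n (x.1 + 1, x.2 + 1) ∪ walkCuts n (x.1 - 1, x.2 + 1))
      ((walkCuts n (x.1, x.2 - 2)).image (insert x))
    have h2 := Finset.card_union_le (walkCuts n (x.1 + 1, x.2 + 1)) (walkCuts n (x.1 - 1, x.2 + 1))
    have h3 := Finset.card_image_le (s := walkCuts n (x.1, x.2 - 2)) (f := insert x)
    have i1 := ih (x.1 + 1, x.2 + 1)
    have i2 := ih (x.1 - 1, x.2 + 1)
    have i3 := ih (x.1, x.2 - 2)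
    rw [walkCuts, pow_succ]
    omega

/-- Trace a site back from the stage at which it first becomes reachable. A down-step lowers the
height by 1 and an up-step raises it by 2, so m + height is at most three times the number of
up-steps. -/
lemma exists_walkCuts_of_mem_reach (Q : Set (ℤ × ℤ)) (n : ℕ) (x : ℤ × ℤ) (hx : x ∈ reach Q n) :
    ∃ m, ∃ C ∈ walkCuts m x, (C : Set (ℤ × ℤ)) ⊆ Q ∧ (C : Set (ℤ × ℤ)) ⊆ reach Q n ∧
      (m : ℤ) + x.2 ≤ 3 * C.card := by
  induction n generalizing x with
  | zero => exact ⟨0, ∅, by simp [walkCuts], by simp, by simp, by simpa [reach] using hx⟩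
  | succ n ih =>
    have hsub : reach Q n ⊆ reach Q (n + 1) := Set.subset_union_left
    by_cases hxn : x ∈ reach Q n
    · obtain ⟨m, C, hC, h1, h2, h3⟩ := ih x hxn
      exact ⟨m, C, hC, h1, h2.trans hsub, h3⟩
    · rcases hx with hx | hx | hx | ⟨hxQ, hx'⟩
      · exact absurd hx hxn
      · obtain ⟨m, C, hC, h1, h2, h3⟩ := ih _ hx
        refine ⟨m + 1, C, by simp [walkCuts, hC], h1, h2.trans hsub, ?_⟩
        push_cast; simp only at h3; linarith
      · obtain ⟨m, C, hC, h1, h2, h3⟩ := ih _ hx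
        refine ⟨m + 1, C, by simp [walkCuts, hC], h1, h2.trans hsub, ?_⟩
        push_cast; simp only at h3; linarith
      · obtain ⟨m, C, hC, h1, h2, h3⟩ := ih _ hx'
        -- Earlier up-steps enter sites reached by stage n, and x is new, so the up-steps enter
        -- distinct sites and `C.card` counts them all.
        have hxC : x ∉ C := fun h => hxn (h2 h)
        refine ⟨m + 1, insert x C, ?_, ?_, ?_, ?_⟩
        · rw [walkCuts]
          exact Finset.mem_union_right _ (Finset.mem_image_of_mem _ hC)
        · rw [Finset.coe_insert]
          exact Set.insert_subset hxQ h1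
        · rw [Finset.coe_insert]
          exact Set.insert_subset (Or.inr (Or.inr (Or.inr ⟨hxQ, hx'⟩))) (h2.trans hsub)
        · rw [Finset.card_insert_of_notMem hxC]
          push_cast; simp only at h3; linarith

/-! ### Planar duality: a crossing or a cut -/

/-- The sites that can be reached from below the axis. -/
def reachable (Q : Set (ℤ × ℤ)) : Set (ℤ × ℤ) := ⋃ n, reach Q n

section reachable

variable {Q : Set (ℤ × ℤ)} {k j : ℤ}

lemma mem_reachable_of_nonpos (hj : j ≤ 0) : (k, j) ∈ reachable Q :=
  Set.mem_iUnion.2 ⟨0, hj⟩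

lemma mem_reachable_right (h : (k, j) ∈ reachable Q) : (k + 1, j - 1) ∈ reachable Q := by
  obtain ⟨n, hn⟩ := Set.mem_iUnion.1 h
  refine Set.mem_iUnion.2 ⟨n + 1, Or.inr (Or.inr (Or.inl ?_))⟩
  simpa using hn

lemma mem_reachable_left (h : (k, j) ∈ reachable Q) : (k - 1, j - 1) ∈ reachable Q := by
  obtain ⟨n, hn⟩ := Set.mem_iUnion.1 h
  refine Set.mem_iUnion.2 ⟨n + 1, Or.inr (Or.inl ?_)⟩
  simpa using hn

lemma mem_reachable_up (hQ : (k, j) ∈ Q) (h : (k, j - 2) ∈ reachable Q) :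
    (k, j) ∈ reachable Q := by
  obtain ⟨n, hn⟩ := Set.mem_iUnion.1 h
  exact Set.mem_iUnion.2 ⟨n + 1, Or.inr (Or.inr (Or.inr ⟨hQ, hn⟩))⟩

lemma mem_reachable_down (h : (k, j) ∈ reachable Q) (m : ℕ) :
    (k, j - 2 * m) ∈ reachable Q := by
  induction m with
  | zero => simpa using h
  | succ m ih =>
    have := mem_reachable_left (mem_reachable_right ih)
    convert this using 2
    · ring
    · push_cast; ring

lemma mem_reachable_of_le {j' : ℤ} (h : (k, j) ∈ reachable Q) (hle : j' ≤ j)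
    (hmod : j' ≡ j [ZMOD 2]) : (k, j') ∈ reachable Q := by
  obtain ⟨c, hc⟩ := hmod.dvd
  have := mem_reachable_down h c.toNat
  have hc0 : 0 ≤ c := by omega
  rw [Int.toNat_of_nonneg hc0] at this
  convert this using 2
  omega

/-- Only up-steps gain height, and they end in the half diamond, whose sites have height at most K.
Hence every column contains unreachable sites. -/
lemma le_of_mem_reachable {K : ℕ} (hQ : Q ⊆ halfDiamond K) {x : ℤ × ℤ} (hx : x ∈ reachable Q) :
    x.2 ≤ K := by
  obtain ⟨n, hn⟩ := Set.mem_iUnion.1 hx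
  clear hx
  induction n generalizing x with
  | zero => exact le_trans hn (by positivity)
  | succ n ih =>
    rcases hn with h | h | h | ⟨h, -⟩
    · exact ih h
    · have := ih h; simp only at this; omega
    · have := ih h; simp only at this; omega
    · obtain ⟨-, h2, h3, -⟩ := hQ h
      omega

/-- The lowest site of each column that cannot be reached traces a path with steps `±1`. -/
lemma exists_lipschitz {K : ℕ} (hQ : Q ⊆ halfDiamond K) :
    ∃ g : ℤ → ℤ, ∀ k, 1 ≤ g k ∧ g k ≡ k [ZMOD 2] ∧ (k, g k) ∉ reachable Q ∧
      (k, g k) ∉ Q ∧ |g (k + 1) - g k| = 1 ∧ ((k, 1) ∉ reachable Q → k ≡ 1 [ZMOD 2] → g k = 1) := by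
  classical
  have hex : ∀ k : ℤ, ∃ j : ℕ, (j : ℤ) ≡ k [ZMOD 2] ∧ (k, (j : ℤ)) ∉ reachable Q := by
    intro k
    have hbig : ∀ j : ℤ, (K : ℤ) < j → (k, j) ∉ reachable Q := fun j hj h =>
      absurd (le_of_mem_reachable hQ h) (by simpa using hj)
    rcases Int.emod_two_eq_zero_or_one (k - K) with h | h
    · refine ⟨K + 2, ?_, hbig _ (by push_cast; omega)⟩
      simp only [Int.ModEq]; push_cast; omega
    · refine ⟨K + 1, ?_, hbig _ (by push_cast; omega)⟩
      simp only [Int.ModEq]; push_cast; omega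
  have hmod : ∀ k, (Nat.find (hex k) : ℤ) ≡ k [ZMOD 2] := fun k => (Nat.find_spec (hex k)).1
  have hnot : ∀ k, (k, (Nat.find (hex k) : ℤ)) ∉ reachable Q := fun k =>
    (Nat.find_spec (hex k)).2
  have hpos : ∀ k, 1 ≤ (Nat.find (hex k) : ℤ) := by
    intro k
    by_contra! h
    exact hnot k (mem_reachable_of_nonpos (by omega))
  -- By minimality, or because it lies below the axis, the site two below the minimum is reachable.
  -- So the minimum is not in `Q`, as an up-step would reach it, and diagonal steps from two below
  -- bound the minima of the neighbouring columns.
  have hbelow : ∀ k, (k, (Nat.find (hex k) : ℤ) - 2) ∈ reachable Q := by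
    intro k
    by_cases h2 : 2 ≤ Nat.find (hex k)
    · have hm := Nat.find_min (hex k) (m := Nat.find (hex k) - 2) (by omega)
      have hk := hmod k
      rw [not_and, not_not, Nat.cast_sub h2] at hm
      exact hm (by simp only [Int.ModEq] at hk ⊢; push_cast; omega)
    · exact mem_reachable_of_nonpos (by omega)
  have hright : ∀ k, (Nat.find (hex k) : ℤ) - 1 ≤ Nat.find (hex (k + 1)) := by
    intro k
    by_contra! h
    have h1 := hmod k
    have h2 := hmod (k + 1)
    refine hnot (k + 1) (mem_reachable_of_le (mem_reachable_right (hbelow k)) ?_ ?_) <;>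
    simp only [Int.ModEq] at * <;> omega
  have hleft : ∀ k, (Nat.find (hex (k + 1)) : ℤ) - 1 ≤ Nat.find (hex k) := by
    intro k
    by_contra! h
    have h1 := hmod k
    have h2 := hmod (k + 1)
    have h3 := mem_reachable_left (hbelow (k + 1))
    rw [add_sub_cancel_right] at h3
    refine hnot k (mem_reachable_of_le h3 ?_ ?_) <;>
    simp only [Int.ModEq] at * <;> omega
  refine ⟨fun k => Nat.find (hex k), fun k => ⟨hpos k, hmod k, hnot k,
    fun h => hnot k (mem_reachable_up h (hbelow k)), ?_, ?_⟩⟩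
  -- Neighbouring minima have opposite parity, so a difference of at most 1 has absolute value
  -- exactly 1.
  · have h1 := hmod k
    have h2 := hmod (k + 1)
    have h3 := hright k
    have h4 := hleft k
    rw [abs_eq zero_le_one]
    simp only [Int.ModEq] at *
    omega
  · intro h hk
    have := Nat.find_min' (hex k) (m := 1) ⟨by simpa using hk.symm, by simpa using h⟩
    have := hpos k
    simp only
    omega

end reachable

/-- If the two sites next to the apexes cannot be reached, then the diamond is crossed by a path
that avoids `Q`. -/
lemma exists_crossing {K : ℕ} {Q : Set (ℤ × ℤ)} (hQ : Q ⊆ halfDiamond K)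
    (hs : ((1 : ℤ), (1 : ℤ)) ∉ reachable Q) (ht : (2 * (K : ℤ) - 1, (1 : ℤ)) ∉ reachable Q) :
    ∃ G : ℕ → ℤ, G 0 = 0 ∧ G (2 * K) = 0 ∧ (∀ k < 2 * K, |G (k + 1) - G k| = 1) ∧
      ∀ k, 0 < k → k < 2 * K → ((k : ℤ), G k) ∈ halfDiamond K ∧ ((k : ℤ), G k) ∉ Q := by
  obtain ⟨g, hg⟩ := exists_lipschitz hQ
  have hg1 : g 1 = 1 := (hg 1).2.2.2.2.2 hs rfl
  have hgt : g (2 * (K : ℤ) - 1) = 1 :=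
    (hg _).2.2.2.2.2 ht (by simp only [Int.ModEq]; omega)
  have hstep : ∀ k, |g (k + 1) - g k| ≤ 1 := fun k => (hg k).2.2.2.2.1.le
  -- Height 1 beside each apex and slope at most 1 keep the path between the sides of the diamond.
  have hup : ∀ m : ℕ, g (1 + m) ≤ 1 + m := by
    intro m
    induction m with
    | zero => simp [hg1]
    | succ m ih =>
      have := (abs_le.1 (hstep (1 + m))).2
      push_cast
      rw [← add_assoc]
      linarith
  have hdown : ∀ m : ℕ, g (2 * (K : ℤ) - 1 - m) ≤ 1 + m := by
    intro m
    induction m with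
    | zero => simp [hgt]
    | succ m ih =>
      have := (abs_le.1 (hstep (2 * (K : ℤ) - 1 - (m + 1 : ℕ)))).1
      rw [show 2 * (K : ℤ) - 1 - (m + 1 : ℕ) + 1 = 2 * (K : ℤ) - 1 - m by push_cast; ring] at this
      push_cast at this ⊢
      linarith
  -- Since g ≥ 1 everywhere, the values at the apexes are reset to 0; the neighbouring height 1
  -- keeps the end steps of size 1.
  refine ⟨fun k => if k = 0 ∨ k = 2 * K then 0 else g k, by simp, by simp, ?_, ?_⟩
  · intro k hk
    beta_reduce
    by_cases hk0 : k = 0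
    · subst hk0
      rw [if_neg (by omega), if_pos (by simp)]
      simp [hg1]
    · rw [if_neg (by omega : ¬ (k = 0 ∨ k = 2 * K))]
      by_cases hk1 : k + 1 = 2 * K
      · rw [if_pos (Or.inr hk1), show (k : ℤ) = 2 * (K : ℤ) - 1 by omega, hgt]
        simp
      · rw [if_neg (by omega)]
        exact_mod_cast (hg k).2.2.2.2.1
  · intro k hk0 hk
    simp only [if_neg (by omega : ¬ (k = 0 ∨ k = 2 * K))]
    refine ⟨⟨(hg k).1, ?_, ?_, (hg k).2.1⟩, (hg k).2.2.2.1⟩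
    · have := hup (k - 1)
      rw [show (1 : ℤ) + (k - 1 : ℕ) = k by omega] at this
      exact this
    · have := hdown (2 * K - 1 - k)
      rw [show 2 * (K : ℤ) - 1 - (2 * K - 1 - k : ℕ) = k by omega] at this
      simp only
      omega

/-- There are few sets of sites that together block all crossings of the half diamond. -/
lemma exists_cut_family (K : ℕ) :
    ∃ F : Finset (Finset (ℤ × ℤ)),
      (∀ C ∈ F, (C : Set (ℤ × ℤ)) ⊆ halfDiamond K) ∧
      (∀ Q : Set (ℤ × ℤ), Q ⊆ halfDiamond K → (∀ C ∈ F, ¬ (C : Set (ℤ × ℤ)) ⊆ Q) →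
        ∃ G : ℕ → ℤ, G 0 = 0 ∧ G (2 * K) = 0 ∧ (∀ k < 2 * K, |G (k + 1) - G k| = 1) ∧
          ∀ k, 0 < k → k < 2 * K → ((k : ℤ), G k) ∈ halfDiamond K ∧ ((k : ℤ), G k) ∉ Q) ∧
      ∀ y : ℝ, 0 ≤ y → y ≤ 1 / 6 → ∑ C ∈ F, (y ^ 3) ^ C.card ≤ 4 * y := by
  classical
  set D := (halfDiamond_finite K).toFinset with hD
  -- The bound m + 1 ≤ 3 |C| makes the weight y^(3|C|) at most y^(m+1), and with C inside the finite
  -- half diamond it leaves only finitely many m.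
  let T : ℕ → ℤ × ℤ → Finset (Finset (ℤ × ℤ)) := fun m x =>
    (walkCuts m x).filter fun C => (C : Set (ℤ × ℤ)) ⊆ halfDiamond K ∧ m + 1 ≤ 3 * C.card
  let E : ℕ → Finset (Finset (ℤ × ℤ)) := fun m => T m (1, 1) ∪ T m (2 * (K : ℤ) - 1, 1)
  have hmem : ∀ Q : Set (ℤ × ℤ), Q ⊆ halfDiamond K → ∀ k : ℤ, (k, 1) ∈ reachable Q →
      ∃ m < 3 * D.card, ∃ C ∈ T m (k, 1), (C : Set (ℤ × ℤ)) ⊆ Q := by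
    intro Q hQ k hk
    obtain ⟨n, hn⟩ := Set.mem_iUnion.1 hk
    obtain ⟨m, C, hC, h1, -, h3⟩ := exists_walkCuts_of_mem_reach Q n _ hn
    have hCD : C.card ≤ D.card := Finset.card_le_card fun c hc => by
      rw [hD, Set.Finite.mem_toFinset]
      exact hQ (h1 hc)
    simp only at h3
    exact ⟨m, by omega, C, Finset.mem_filter.2 ⟨hC, h1.trans hQ, by omega⟩, h1⟩
  refine ⟨(Finset.range (3 * D.card)).biUnion E, ?_, ?_, ?_⟩
  · intro C hC
    obtain ⟨m, -, hm⟩ := Finset.mem_biUnion.1 hC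
    rcases Finset.mem_union.1 hm with h | h <;> exact (Finset.mem_filter.1 h).2.1
  · intro Q hQ hF
    apply exists_crossing hQ
    · intro h
      obtain ⟨m, hm, C, hC, hCQ⟩ := hmem Q hQ _ h
      exact hF C (Finset.mem_biUnion.2 ⟨m, Finset.mem_range.2 hm, Finset.mem_union_left _ hC⟩) hCQ
    · intro h
      obtain ⟨m, hm, C, hC, hCQ⟩ := hmem Q hQ _ h
      exact hF C (Finset.mem_biUnion.2 ⟨m, Finset.mem_range.2 hm, Finset.mem_union_right _ hC⟩) hCQ
  · intro y hy0 hy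
    have hT : ∀ m x, ∑ C ∈ T m x, (y ^ 3) ^ C.card ≤ y * (3 * y) ^ m := by
      intro m x
      calc ∑ C ∈ T m x, (y ^ 3) ^ C.card ≤ ∑ C ∈ T m x, y ^ (m + 1) := by
            refine Finset.sum_le_sum fun C hC => ?_
            rw [← pow_mul]
            exact pow_le_pow_of_le_one hy0 (by linarith) (Finset.mem_filter.1 hC).2.2
        _ = (T m x).card * y ^ (m + 1) := by rw [Finset.sum_const, nsmul_eq_mul]
        _ ≤ 3 ^ m * y ^ (m + 1) := by
            gcongr
            exact_mod_cast (Finset.card_filter_le _ _).trans (card_walkCuts_le m x)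
        _ = y * (3 * y) ^ m := by rw [mul_pow]; ring
    -- The factor 2 counts the two apexes; y ≤ 1/6 makes the ratio 3y at most 1/2.
    have hE : ∀ m, ∑ C ∈ E m, (y ^ 3) ^ C.card ≤ 2 * y * (1 / 2) ^ m := by
      intro m
      have h1 : ∑ C ∈ E m, (y ^ 3) ^ C.card ≤
          ∑ C ∈ T m (1, 1), (y ^ 3) ^ C.card + ∑ C ∈ T m (2 * (K : ℤ) - 1, 1), (y ^ 3) ^ C.card := by
        rw [← Finset.sum_union_inter]
        exact le_add_of_nonneg_right (Finset.sum_nonneg fun C _ => by positivity)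
      have h2 : y * (3 * y) ^ m ≤ y * (1 / 2) ^ m := by
        gcongr
        linarith
      linarith [hT m (1, 1), hT m (2 * (K : ℤ) - 1, 1)]
    have hbi : ∀ N : ℕ, ∑ C ∈ (Finset.range N).biUnion E, (y ^ 3) ^ C.card ≤
        ∑ m ∈ Finset.range N, ∑ C ∈ E m, (y ^ 3) ^ C.card := by
      intro N
      induction N with
      | zero => simp
      | succ N ih =>
        rw [Finset.sum_range_succ, Finset.range_add_one, Finset.biUnion_insert]
        have h1 := Finset.sum_union_inter (s₁ := E N) (s₂ := (Finset.range N).biUnion E)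
          (f := fun C => (y ^ 3) ^ C.card)
        have h2 : 0 ≤ ∑ C ∈ E N ∩ (Finset.range N).biUnion E, (y ^ 3) ^ C.card :=
          Finset.sum_nonneg fun C _ => by positivity
        linarith
    calc _ ≤ ∑ m ∈ Finset.range (3 * D.card), 2 * y * (1 / 2) ^ m :=
          (hbi _).trans (Finset.sum_le_sum fun m _ => hE m)
      _ = 2 * y * ∑ m ∈ Finset.range (3 * D.card), (1 / 2 : ℝ) ^ m := by rw [Finset.mul_sum]
      _ ≤ 2 * y * 2 := by
          gcongr
          exact sum_geometric_two_le _
      _ = 4 * y := by ring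

/-! ### Negative correlation of empty sets -/

/-- For independent points that hit each of some disjoint sets with the same probability `p`, the
events that these sets are missed are negatively correlated. -/
lemma measureReal_forall_notMem_le {Ω E ι : Type*} [MeasurableSpace Ω] [MeasurableSpace E]
    {P : Measure Ω} [IsProbabilityMeasure P] {n : ℕ} {X : Fin n → Ω → E}
    (hX : ∀ i, Measurable (X i)) (hind : iIndepFun X P) (C : Finset ι) (S : ι → Set E)
    (hS : ∀ a ∈ C, MeasurableSet (S a)) (hdisj : (C : Set ι).PairwiseDisjoint S) (p : ℝ)
    (hp : ∀ i, ∀ a ∈ C, P.real (X i ⁻¹' S a) = p) :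
    P.real {ω | ∀ a ∈ C, ∀ i, X i ω ∉ S a} ≤ ((1 - p) ^ n) ^ C.card := by
  rcases C.eq_empty_or_nonempty with rfl | hne
  · simp
  have hU : MeasurableSet (⋃ a ∈ C, S a) := Finset.measurableSet_biUnion _ hS
  have hset : {ω | ∀ a ∈ C, ∀ i, X i ω ∉ S a} =
      ⋂ i ∈ (Finset.univ : Finset (Fin n)), X i ⁻¹' (⋃ a ∈ C, S a)ᶜ := by
    ext ω
    simp only [Set.mem_ofPred_eq, Finset.mem_univ, Set.iInter_true, Set.mem_iInter,
      Set.mem_preimage, Set.mem_compl_iff, Set.mem_iUnion, not_exists]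
    exact ⟨fun h i a ha => h a ha i, fun h a ha i => h i a ha⟩
  have hone : ∀ i, P.real (X i ⁻¹' (⋃ a ∈ C, S a)ᶜ) = 1 - C.card * p := by
    intro i
    rw [Set.preimage_compl, probReal_compl_eq_one_sub (hX i hU), Set.preimage_iUnion₂,
      measureReal_biUnion_finset (fun a ha b hb hab => (hdisj ha hb hab).preimage (X i))
        (fun a ha => hX i (hS a ha)), Finset.sum_congr rfl (hp i), Finset.sum_const, nsmul_eq_mul]
  have hprod : P.real {ω | ∀ a ∈ C, ∀ i, X i ω ∉ S a} = (1 - C.card * p) ^ n := by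
    rw [hset, measureReal_def, hind.measure_inter_preimage_eq_mul Finset.univ fun _ _ => hU.compl,
      ENNReal.toReal_prod]
    simp_rw [← measureReal_def, hone]
    simp
  rw [hprod]
  -- Some point and some set are needed for `hp` to make `p` a probability; then Bernoulli's
  -- inequality gives 1 - |C| p ≤ (1 - p)^|C|.
  rcases Nat.eq_zero_or_pos n with rfl | hn
  · simp
  obtain ⟨a, ha⟩ := hne
  have hp1 : p ≤ 1 := hp ⟨0, hn⟩ a ha ▸ measureReal_le_one
  have hnn : 0 ≤ 1 - C.card * p := hone ⟨0, hn⟩ ▸ measureReal_nonneg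
  rw [← pow_mul, mul_comm n, pow_mul]
  refine pow_le_pow_left₀ hnn ?_ n
  have := one_add_mul_le_pow (a := -p) (by linarith) C.card
  rw [← sub_eq_add_neg] at this
  linarith

/-! ### Geometry of the boxes -/

section box

variable {d : ℕ} [NeZero d] (b : OrthonormalBasis (Fin d) ℝ (EuclideanSpace ℝ (Fin d)))
  (s : EuclideanSpace ℝ (Fin d)) (l h : ℝ)

lemma isClosed_box (z : Fin d → ℤ) : IsClosed (box b s l h z) := by
  have hc : ∀ i, Continuous fun x : EuclideanSpace ℝ (Fin d) => b.repr (x - s) i := by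
    intro i
    fun_prop
  refine (isClosed_le continuous_const (hc 0)).inter
    ((isClosed_le (hc 0) continuous_const).inter ?_)
  have : {x | ∀ i : Fin d, i ≠ 0 → (-1 / 2 + (z i : ℝ)) * h ≤ b.repr (x - s) i ∧
      b.repr (x - s) i ≤ (1 / 2 + (z i : ℝ)) * h} =
      ⋂ i : Fin d, ⋂ _ : i ≠ 0, {x | (-1 / 2 + (z i : ℝ)) * h ≤ b.repr (x - s) i} ∩
        {x | b.repr (x - s) i ≤ (1 / 2 + (z i : ℝ)) * h} := by
    ext x
    simp
  change IsClosed {x | ∀ i : Fin d, i ≠ 0 → (-1 / 2 + (z i : ℝ)) * h ≤ b.repr (x - s) i ∧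
      b.repr (x - s) i ≤ (1 / 2 + (z i : ℝ)) * h}
  rw [this]
  exact isClosed_iInter fun i => isClosed_iInter fun _ =>
    (isClosed_le continuous_const (hc i)).inter (isClosed_le (hc i) continuous_const)

/-- Boxes are translates of one another. -/
lemma volume_box_eq (z z' : Fin d → ℤ) :
    volume (box b s l h z) = volume (box b s l h z') := by
  let v : EuclideanSpace ℝ (Fin d) := b.repr.symm
    (WithLp.toLp 2 fun i => if i = 0 then l * ((z' i : ℝ) - z i) else ((z' i : ℝ) - z i) * h)
  have hrepr : ∀ x i, b.repr (x + v - s) i = b.repr (x - s) i +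
      if i = 0 then l * ((z' i : ℝ) - z i) else ((z' i : ℝ) - z i) * h := by
    intro x i
    rw [add_sub_right_comm, map_add, PiLp.add_apply]
    simp [v]
  have hbox : box b s l h z = (fun x => x + v) ⁻¹' box b s l h z' := by
    ext x
    simp only [box, Set.mem_ofPred_eq, Set.mem_preimage, hrepr, if_true]
    refine and_congr ?_ (and_congr ?_ (forall_congr' fun i => imp_congr_right fun hi => ?_))
    · constructor <;> intro <;> linarith
    · constructor <;> intro <;> linarith
    · rw [if_neg hi]
      refine and_congr ?_ ?_ <;> constructor <;> intro <;> linarith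
  rw [hbox, measure_preimage_add_right]

variable {b s l h}

/-- By the parity conditions, distinct channel indices differ by at least 2 in some coordinate,
which leaves a gap even between closed boxes. -/
lemma disjoint_box (hl : 0 < l) (hh : 0 < h) {K : ℕ} {z z' : Fin d → ℤ} (hz : IsChannelIndex K z)
    (hz' : IsChannelIndex K z') (hne : z ≠ z') : Disjoint (box b s l h z) (box b s l h z') := by
  have hgap : ∀ {ε a u : ℝ} {m m' : ℤ}, 0 < ε → m ≡ m' [ZMOD 2] → m ≠ m' →
      (a + m) * ε ≤ u → u ≤ (a + 1 + m) * ε → (a + m') * ε ≤ u → u ≤ (a + 1 + m') * ε → False := by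
    intro ε a u m m' hε hmod hmm h1 h2 h3 h4
    have hlt : m + 1 < m' ∨ m' + 1 < m := by
      simp only [Int.ModEq] at hmod
      omega
    rcases hlt with hlt | hlt
    · have : (m : ℝ) + 1 < m' := by exact_mod_cast hlt
      have := lt_of_mul_lt_mul_right (h3.trans h2 |>.trans_lt
        (mul_lt_mul_of_pos_right (show a + 1 + (m : ℝ) < a + m' by linarith) hε)) hε.le
      linarith
    · have : (m' : ℝ) + 1 < m := by exact_mod_cast hlt
      have := lt_of_mul_lt_mul_right (h1.trans h4 |>.trans_lt
        (mul_lt_mul_of_pos_right (show a + 1 + (m' : ℝ) < a + m by linarith) hε)) hε.le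
      linarith
  rw [Set.disjoint_left]
  rintro x ⟨h1, h2, h3⟩ ⟨h1', h2', h3'⟩
  obtain ⟨k, -, -, hk, hzi⟩ := hz
  obtain ⟨k', -, -, hk', hzi'⟩ := hz'
  by_cases h0 : z 0 = z' 0
  · obtain ⟨i, hi⟩ := Function.ne_iff.1 hne
    have hi0 : i ≠ 0 := fun h => hi (h ▸ h0)
    have hkk : k = k' := by omega
    have hmod : z i ≡ z' i [ZMOD 2] := (hzi i hi0).2.trans (hkk ▸ (hzi' i hi0).2.symm)
    exact hgap (a := -1 / 2) hh hmod hi (h3 i hi0).1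
      ((h3 i hi0).2.trans_eq (by ring)) (h3' i hi0).1 ((h3' i hi0).2.trans_eq (by ring))
  · have hmod : z 0 ≡ z' 0 [ZMOD 2] := by
      rw [hk, hk']
      simp [Int.ModEq]
    exact hgap (a := 0) hl hmod h0 (le_trans (le_of_eq (by ring)) h1)
      (h2.trans_eq (by ring)) (le_trans (le_of_eq (by ring)) h1') (h2'.trans_eq (by ring))

lemma start_mem_box (hl : 0 < l) (hh : 0 < h) : s ∈ box b s l h 0 := by
  refine ⟨by simp, by simpa using hl.le, fun i _ => ?_⟩
  simp only [sub_self, map_zero, PiLp.zero_apply, Pi.zero_apply, Int.cast_zero]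
  constructor <;> linarith

lemma repr_sub_apply {t : EuclideanSpace ℝ (Fin d)} {w : ℝ} (ht : t - s = w • b 0) (i : Fin d) :
    b.repr (t - s) i = if i = 0 then w else 0 := by
  rw [ht, map_smul, OrthonormalBasis.repr_self, PiLp.smul_apply, PiLp.single_apply]
  simp

lemma end_mem_box {t : EuclideanSpace ℝ (Fin d)} {w : ℝ} {K : ℕ} (hh : 0 < h)
    (hl : 0 < l) (ht : t - s = w • b 0) (hw : w = l * (4 * (K : ℝ) + 1)) :
    t ∈ box b s l h (endIndex d K) := by
  refine ⟨?_, ?_, fun i hi => ?_⟩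
  · rw [repr_sub_apply ht, if_pos rfl, hw]
    simp only [endIndex, Pi.single_eq_same]
    push_cast
    linarith
  · rw [repr_sub_apply ht, if_pos rfl, hw]
    simp [endIndex]
  · rw [repr_sub_apply ht, if_neg hi]
    simp only [endIndex, Pi.single_eq_of_ne hi, Int.cast_zero]
    constructor <;> linarith

/-- Along the first axis the box lies strictly between s and t, so only the random points matter. -/
lemma isEmptyBox_vertexSet_iff {t : EuclideanSpace ℝ (Fin d)} {w : ℝ} {K : ℕ} (hl : 0 < l)
    (ht : t - s = w • b 0) (hw : w = l * (4 * (K : ℝ) + 1)) {z : Fin d → ℤ} (h0 : 0 < z 0)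
    (hK : z 0 < 4 * (K : ℤ)) {n : ℕ} (x : Fin n → EuclideanSpace ℝ (Fin d)) :
    IsEmptyBox b s l h (vertexSet s t x) z ↔ ∀ i, x i ∉ box b s l h z := by
  have hs : s ∉ box b s l h z := by
    rintro ⟨h1, -, -⟩
    rw [sub_self, map_zero, PiLp.zero_apply] at h1
    have : (0 : ℝ) < z 0 := by exact_mod_cast h0
    nlinarith
  have ht' : t ∉ box b s l h z := by
    rintro ⟨-, h2, -⟩
    rw [repr_sub_apply ht, if_pos rfl, hw] at h2
    have h3 := le_of_mul_le_mul_left h2 hl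
    have : (z 0 : ℝ) < 4 * K := by exact_mod_cast hK
    linarith
  rw [IsEmptyBox, ← Set.disjoint_iff_inter_eq_empty, Set.disjoint_left]
  constructor
  · intro H i hi
    exact H hi (Or.inr ⟨i, rfl⟩)
  · rintro H y hy ((rfl | rfl) | ⟨i, rfl⟩)
    exacts [hs hy, ht' hy, H i hy]

end box

/-! ### Embedding the half diamonds in the channel -/

section embed

variable {d : ℕ} [NeZero d]

/-- The index of the box in the plane with signs `σ` that corresponds to a planar site. -/
def signedIndex (σ : {i : Fin d // i ≠ 0} → ℤˣ) (x : ℤ × ℤ) : Fin d → ℤ :=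
  fun i => if hi : i = 0 then 2 * x.1 else σ ⟨i, hi⟩ * x.2

lemma signedIndex_zero (σ : {i : Fin d // i ≠ 0} → ℤˣ) (x : ℤ × ℤ) :
    signedIndex σ x 0 = 2 * x.1 := by
  simp [signedIndex]

lemma signedIndex_of_ne (σ : {i : Fin d // i ≠ 0} → ℤˣ) (x : ℤ × ℤ) {i : Fin d} (hi : i ≠ 0) :
    signedIndex σ x i = σ ⟨i, hi⟩ * x.2 := by
  simp [signedIndex, hi]

lemma isChannelIndex_signedIndex (σ : {i : Fin d // i ≠ 0} → ℤˣ) {K : ℕ} {x : ℤ × ℤ}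
    (hx : x ∈ halfDiamond K) : IsChannelIndex K (signedIndex σ x) := by
  obtain ⟨h1, h2, h3, h4⟩ := hx
  refine ⟨x.1, by omega, by omega, signedIndex_zero σ x, fun i hi => ?_⟩
  rw [signedIndex_of_ne σ x hi]
  simp only [Int.ModEq] at *
  rcases Int.units_eq_one_or (σ ⟨i, hi⟩) with h | h <;> rw [h]
  · rw [Units.val_one, one_mul, abs_of_pos (by omega)]
    omega
  · rw [Units.val_neg, Units.val_one, neg_one_mul, abs_neg, abs_of_pos (by omega)]
    omega

/-- Off the axis each transverse coordinate reveals its sign and the height; d ≥ 2 provides such a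
coordinate. This makes the half diamonds box-disjoint. -/
lemma signedIndex_injective (hd : 2 ≤ d) {σ τ : {i : Fin d // i ≠ 0} → ℤˣ} {x y : ℤ × ℤ}
    (hx : 1 ≤ x.2) (hy : 1 ≤ y.2) (h : signedIndex σ x = signedIndex τ y) : σ = τ ∧ x = y := by
  have h1 : x.1 = y.1 := by
    have := congrFun h 0
    rw [signedIndex_zero, signedIndex_zero] at this
    omega
  have h2 : ∀ i, x.2 = y.2 ∧ σ i = τ i := by
    rintro ⟨i, hi⟩
    have := congrFun h i
    rw [signedIndex_of_ne _ _ hi, signedIndex_of_ne _ _ hi] at this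
    rcases Int.units_eq_one_or (σ ⟨i, hi⟩) with h | h <;>
    rcases Int.units_eq_one_or (τ ⟨i, hi⟩) with h' | h' <;>
    simp only [h, h', Units.val_one, Units.val_neg] at this ⊢ <;> simp <;> omega
  have hi : (⟨1, by omega⟩ : Fin d) ≠ 0 := by
    simp [Fin.ext_iff]
  exact ⟨funext fun i => (h2 i).2, Prod.ext h1 (h2 ⟨_, hi⟩).1⟩

/-- A crossing of the half diamond with non-empty boxes, in the plane with signs `σ`, is a
jump-path. -/
lemma hasJumpPath_of_crossing {b : OrthonormalBasis (Fin d) ℝ (EuclideanSpace ℝ (Fin d))}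
    {s : EuclideanSpace ℝ (Fin d)} {K : ℕ} {l h : ℝ} {V : Set (EuclideanSpace ℝ (Fin d))}
    (hs : ¬ IsEmptyBox b s l h V 0) (ht : ¬ IsEmptyBox b s l h V (endIndex d K))
    (σ : {i : Fin d // i ≠ 0} → ℤˣ) (G : ℕ → ℤ) (h0 : G 0 = 0) (hK : G (2 * K) = 0)
    (hstep : ∀ k < 2 * K, |G (k + 1) - G k| = 1)
    (hG : ∀ k : ℕ, 0 < k → k < 2 * K → ¬ IsEmptyBox b s l h V (signedIndex σ (k, G k))) :
    HasJumpPath b s K l h V := by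
  have hB0 : signedIndex σ (((0 : ℕ) : ℤ), G 0) = 0 := by
    ext i
    by_cases hi : i = 0 <;> simp [signedIndex, hi, h0]
  have hBK : signedIndex σ (((2 * K : ℕ) : ℤ), G (2 * K)) = endIndex d K := by
    ext i
    by_cases hi : i = 0
    · subst hi
      rw [signedIndex_zero]
      simp only [endIndex, Pi.single_eq_same]
      push_cast
      ring
    · simp [signedIndex, hi, hK, endIndex]
  refine ⟨fun k => signedIndex σ (k, G k), hB0, hBK, fun k hk => ⟨?_, fun i hi => ?_⟩,
    fun k hk => ?_⟩
  · simp only [signedIndex_zero]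
    push_cast
    ring
  · beta_reduce
    rw [signedIndex_of_ne _ _ hi, signedIndex_of_ne _ _ hi, ← mul_sub, abs_mul, hstep k hk]
    rcases Int.units_eq_one_or (σ ⟨i, hi⟩) with h | h <;> simp [h]
  · rcases Nat.eq_zero_or_pos k with rfl | hk0
    · simpa only [hB0] using hs
    · rcases hk.eq_or_lt with rfl | hk
      · simpa only [hBK] using ht
      · exact hG k hk0 hk

lemma card_signs : Fintype.card ({i : Fin d // i ≠ 0} → ℤˣ) = 2 ^ (d - 1) := by
  simp [Fintype.card_subtype_compl]

end embed

/-! ### Union bound over all half diamonds -/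

lemma sum_piFinset_prod {ι κ : Type*} [Fintype ι] [DecidableEq ι] (F : Finset κ) (f : κ → ℝ) :
    ∑ φ ∈ Fintype.piFinset fun _ : ι => F, ∏ i, f (φ i) = ∏ _i : ι, ∑ C ∈ F, f C :=
  (Finset.prod_univ_sum (fun _ => F) fun _ C => f C).symm

/-- In the first and last layers min(k, 2K - k) = 0, so only the two end boxes occur there. -/
lemma index_bounds {d : ℕ} [NeZero d] {K : ℕ} {z : Fin d → ℤ} (hz : IsChannelIndex K z)
    (h0 : z ≠ 0) (hend : z ≠ endIndex d K) : 0 < z 0 ∧ z 0 < 4 * (K : ℤ) := by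
  obtain ⟨k, hk0, hkK, hk, hi⟩ := hz
  constructor
  · by_contra! h
    refine h0 (funext fun i => ?_)
    by_cases hi0 : i = 0
    · rw [hi0, Pi.zero_apply]
      omega
    · have := (hi i hi0).1
      exact abs_nonpos_iff.1 (by omega)
  · by_contra! h
    refine hend (funext fun i => ?_)
    by_cases hi0 : i = 0
    · rw [hi0, endIndex, Pi.single_eq_same]
      omega
    · have := (hi i hi0).1
      rw [endIndex, Pi.single_eq_of_ne hi0]
      exact abs_nonpos_iff.1 (by omega)

/-- With e = 2^(d-3) the two sides are (4y)^(4e) and (4y)^(3e), and 4y ≤ 1. -/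
lemma pow_le_rpow_of_cube_root {d : ℕ} (hd : 2 ≤ d) {y : ℝ} (hy0 : 0 ≤ y) (hy : y ≤ 1 / 6) :
    (4 * y) ^ (2 ^ (d - 1)) ≤ (64 * y ^ 3) ^ ((2 : ℝ) ^ ((d : ℝ) - 3)) := by
  have hexp : ((2 ^ (d - 1) : ℕ) : ℝ) = 4 * (2 : ℝ) ^ ((d : ℝ) - 3) := by
    rw [show (4 : ℝ) = 2 ^ (2 : ℝ) by norm_num, ← Real.rpow_add two_pos, Nat.cast_pow,
      ← Real.rpow_natCast, Nat.cast_sub (by omega)]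
    congr 1
    push_cast
    ring
  have hpos : (0 : ℝ) < (2 : ℝ) ^ ((d : ℝ) - 3) := by positivity
  rw [show 64 * y ^ 3 = (4 * y) ^ (3 : ℝ) by norm_cast; ring, ← Real.rpow_mul (by positivity),
    ← Real.rpow_natCast, hexp]
  exact Real.rpow_le_rpow_of_exponent_ge' (by positivity) (by linarith) (by positivity) (by linarith)

end UnitDiskChannel

open UnitDiskChannel

theorem mainTheorem5 :
    ∃ q₀ : ℝ, 0 < q₀ ∧ q₀ < 1 ∧ ∃ c : ℝ, 0 < c ∧
      ∀ (d : ℕ) [NeZero d], 2 ≤ d →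
      ∀ (n : ℕ) (r h : ℝ), 0 < r → r < 1 → 0 < h →
        h ≤ 1 / 8 * Real.sqrt (7 / ((d : ℝ) - 1)) * r →
      ∀ (s t : EuclideanSpace ℝ (Fin d)) (w : ℝ), w = ‖t - s‖ → r < w →
      ∀ b : OrthonormalBasis (Fin d) ℝ (EuclideanSpace ℝ (Fin d)), t - s = w • b 0 →
      ∀ (K : ℕ) (l : ℝ), K = UnitDiskChannel.channelK w r → l = UnitDiskChannel.channelL w r →
        UnitDiskChannel.channel b s K l h ⊆ UnitDiskChannel.unitCube d →
      ∀ (Ω : Type*) [MeasurableSpace Ω] (P : Measure Ω) [IsProbabilityMeasure P]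
        (X : Fin n → Ω → EuclideanSpace ℝ (Fin d)),
        (∀ i, Measurable (X i)) → iIndepFun X P →
        (∀ i, pdf.IsUniform (X i) (UnitDiskChannel.unitCube d) P volume) →
      ∀ z : Fin d → ℤ, UnitDiskChannel.IsChannelIndex K z →
        z ≠ 0 → z ≠ UnitDiskChannel.endIndex d K →
      ∀ q : ℝ,
        q = P.real {ω | UnitDiskChannel.IsEmptyBox b s l h
              (UnitDiskChannel.vertexSet s t (fun i => X i ω)) z} →
        q < q₀ →
        P.real {ω | ¬ UnitDiskChannel.HasJumpPath b s K l h
              (UnitDiskChannel.vertexSet s t (fun i => X i ω))}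
          ≤ (c * q) ^ ((2 : ℝ) ^ ((d : ℝ) - 3)) := by
  -- 1/216 = (1/6)^3 gives q^(1/3) ≤ 1/6, and 64 = 4^3 comes from the bound 4y.
  refine ⟨1 / 216, by norm_num, by norm_num, 64, by norm_num, ?_⟩
  intro d _ hd n r h hr _ hh _ s t w _ hrw b ht K l hK hl hsub Ω _ P _ X hX hind hunif z hz hz0 hzK
    q hq hq0
  classical
  have hw : w = l * (4 * (K : ℝ) + 1) := by
    rw [hl, channelL, ← hK, div_mul_cancel₀ _ (by positivity)]
  have hl0 : 0 < l := by
    rw [hl, channelL]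
    exact div_pos (hr.trans hrw) (by positivity)
  set p : ℝ := ((volume (unitCube d))⁻¹ * volume (box b s l h z)).toReal with hp
  have hmeas : ∀ z', MeasurableSet (box b s l h z') := fun z' => (isClosed_box b s l h z').measurableSet
  have hcube : MeasurableSet (unitCube d) := by
    have : unitCube d = ⋂ i, ({x : EuclideanSpace ℝ (Fin d) | 0 ≤ x i} ∩ {x | x i ≤ 1}) := by
      ext x
      simp [unitCube]
    rw [this]
    exact (isClosed_iInter fun i => (isClosed_le continuous_const (by fun_prop)).inter
      (isClosed_le (by fun_prop) continuous_const)).measurableSet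
  -- Since the channel lies in the cube, no part of a box is lost, so all boxes have the same
  -- hitting probability.
  have hprob : ∀ i z', IsChannelIndex K z' → P.real (X i ⁻¹' box b s l h z') = p := by
    intro i z' hz'
    have hsub' : box b s l h z' ⊆ unitCube d :=
      (Set.subset_biUnion_of_mem (u := fun z => box b s l h z) hz').trans hsub
    rw [measureReal_def, ← Measure.map_apply (hX i) (hmeas z'), hunif i, cond_apply hcube,
      Set.inter_eq_self_of_subset_right hsub', volume_box_eq b s l h z' z]
  have hzb := index_bounds hz hz0 hzK
  have hqn : q = (1 - p) ^ n := by
    have hset : {ω | IsEmptyBox b s l h (vertexSet s t (fun i => X i ω)) z} =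
        ⋂ i ∈ (Finset.univ : Finset (Fin n)), X i ⁻¹' (box b s l h z)ᶜ := by
      ext ω
      simp [isEmptyBox_vertexSet_iff hl0 ht hw hzb.1 hzb.2]
    rw [hq, hset, measureReal_def,
      hind.measure_inter_preimage_eq_mul Finset.univ fun _ _ => (hmeas z).compl,
      ENNReal.toReal_prod]
    simp_rw [← measureReal_def, Set.preimage_compl,
      fun i => probReal_compl_eq_one_sub (μ := P) (hX i (hmeas z)), fun i => hprob i z hz]
    simp
  have hqnn : 0 ≤ q := hq ▸ measureReal_nonneg
  set y : ℝ := q ^ (3⁻¹ : ℝ) with hydef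
  have hy3 : y ^ 3 = q := by
    rw [hydef, ← Real.rpow_natCast, ← Real.rpow_mul hqnn]
    norm_num
  have hy0 : 0 ≤ y := Real.rpow_nonneg hqnn _
  have hy : y ≤ 1 / 6 := by
    by_contra! hlt
    have := pow_lt_pow_left₀ hlt (by norm_num) (n := 3) (by norm_num)
    rw [hy3] at this
    norm_num at this
    linarith
  obtain ⟨F, hFD, hFcross, hFsum⟩ := exists_cut_family K
  have hDbounds : ∀ (σ : {i : Fin d // i ≠ 0} → ℤˣ), ∀ x ∈ halfDiamond K,
      0 < signedIndex σ x 0 ∧ signedIndex σ x 0 < 4 * (K : ℤ) := by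
    rintro σ x ⟨h1, h2, h3, -⟩
    rw [signedIndex_zero]
    omega
  -- `φ` picks one cut for each sign vector, and `A φ` is the event that no random point hits any
  -- chosen box. The sum over `Φ` of products factorises into a power.
  let Φ := Fintype.piFinset fun _ : {i : Fin d // i ≠ 0} → ℤˣ => F
  let A : (({i : Fin d // i ≠ 0} → ℤˣ) → Finset (ℤ × ℤ)) → Set Ω := fun φ =>
    {ω | ∀ a ∈ (Finset.univ.sigma φ : Finset (Σ _ : {i : Fin d // i ≠ 0} → ℤˣ, ℤ × ℤ)),
      ∀ i, X i ω ∉ box b s l h (signedIndex a.1 a.2)}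
  have hcover : {ω | ¬ HasJumpPath b s K l h (vertexSet s t (fun i => X i ω))} ⊆
      ⋃ φ ∈ Φ, A φ := by
    intro ω hω
    have hcut : ∀ σ : {i : Fin d // i ≠ 0} → ℤˣ, ∃ C ∈ F, ∀ x ∈ C, x ∈ halfDiamond K ∧
        IsEmptyBox b s l h (vertexSet s t (fun i => X i ω)) (signedIndex σ x) := by
      intro σ
      by_contra! hno
      refine hω ?_
      obtain ⟨G, hG0, hGK, hGstep, hG⟩ := hFcross {x | x ∈ halfDiamond K ∧
        IsEmptyBox b s l h (vertexSet s t (fun i => X i ω)) (signedIndex σ x)}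
        (fun x hx => hx.1) (fun C hC hCsub => by
          obtain ⟨x, hx, hx'⟩ := hno C hC
          exact hx' (hCsub hx).1 (hCsub hx).2)
      refine hasJumpPath_of_crossing ?_ ?_ σ G hG0 hGK hGstep fun k hk0 hkK hemp =>
        (hG k hk0 hkK).2 ⟨(hG k hk0 hkK).1, hemp⟩
      · exact Set.Nonempty.ne_empty ⟨s, start_mem_box hl0 hh, by simp [vertexSet]⟩
      · exact Set.Nonempty.ne_empty ⟨t, end_mem_box hh hl0 ht hw, by simp [vertexSet]⟩
    choose φ hφF hφ using hcut
    refine Set.mem_biUnion (Fintype.mem_piFinset.2 hφF : φ ∈ Φ) ?_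
    rintro ⟨σ, x⟩ ha
    have hx := hφ σ x (Finset.mem_sigma.1 ha).2
    exact (isEmptyBox_vertexSet_iff hl0 ht hw (hDbounds σ x hx.1).1 (hDbounds σ x hx.1).2 _).1 hx.2
  have hA : ∀ φ ∈ Φ, P.real (A φ) ≤ ∏ σ, (y ^ 3) ^ (φ σ).card := by
    intro φ hφ
    have hmem : ∀ a ∈ (Finset.univ.sigma φ : Finset (Σ _ : {i : Fin d // i ≠ 0} → ℤˣ, ℤ × ℤ)),
        a.2 ∈ halfDiamond K := fun a ha =>
      hFD _ (Fintype.mem_piFinset.1 hφ a.1) (Finset.mem_sigma.1 ha).2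
    have hdisj : ((Finset.univ.sigma φ : Finset (Σ _ : {i : Fin d // i ≠ 0} → ℤˣ, ℤ × ℤ)) :
        Set (Σ _ : {i : Fin d // i ≠ 0} → ℤˣ, ℤ × ℤ)).PairwiseDisjoint
        fun a => box b s l h (signedIndex a.1 a.2) := by
      rintro ⟨σ, x⟩ ha ⟨τ, x'⟩ ha' hne
      have hx := hmem _ (Finset.mem_coe.1 ha)
      have hx' := hmem _ (Finset.mem_coe.1 ha')
      refine disjoint_box hl0 hh (isChannelIndex_signedIndex σ hx)
        (isChannelIndex_signedIndex τ hx') fun heq => hne ?_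
      obtain ⟨rfl, rfl⟩ := signedIndex_injective hd hx.1 hx'.1 heq
      rfl
    have hle := measureReal_forall_notMem_le hX hind (Finset.univ.sigma φ)
      (fun a => box b s l h (signedIndex a.1 a.2)) (fun a _ => hmeas _) hdisj p
      fun i a ha => hprob i _ (isChannelIndex_signedIndex a.1 (hmem a ha))
    rw [← hqn, Finset.card_sigma, ← Finset.prod_pow_eq_pow_sum, ← hy3] at hle
    exact hle
  calc P.real {ω | ¬ HasJumpPath b s K l h (vertexSet s t (fun i => X i ω))}
      ≤ P.real (⋃ φ ∈ Φ, A φ) :=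
        measureReal_mono hcover (measure_ne_top P _)
    _ ≤ ∑ φ ∈ Φ, P.real (A φ) := measureReal_biUnion_finset_le _ _
    _ ≤ ∑ φ ∈ Φ, ∏ σ, (y ^ 3) ^ (φ σ).card := Finset.sum_le_sum hA
    _ = ∏ _σ : {i : Fin d // i ≠ 0} → ℤˣ, ∑ C ∈ F, (y ^ 3) ^ C.card :=
        sum_piFinset_prod F fun C => (y ^ 3) ^ C.card
    _ = (∑ C ∈ F, (y ^ 3) ^ C.card) ^ (2 ^ (d - 1)) := by
        rw [Finset.prod_const, Finset.card_univ, card_signs]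
    _ ≤ (4 * y) ^ (2 ^ (d - 1)) :=
        pow_le_pow_left₀ (Finset.sum_nonneg fun C _ => by positivity) (hFsum y hy0 hy) _
    _ ≤ (64 * y ^ 3) ^ ((2 : ℝ) ^ ((d : ℝ) - 3)) := pow_le_rpow_of_cube_root hd hy0 hy
    _ = (64 * q) ^ ((2 : ℝ) ^ ((d : ℝ) - 3)) := by rw [hy3]
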